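/- Let $n$ be a natural number. Let $\mathcal L^-\mathrm{GL}_n\mathbb C$ be the full rational loop group, i.e. the group of all invertible $n\times n$ matrices $g\in \mathrm{GL}_n(\mathbb C(\lambda))$ of rational functions that are normalized at $\infty$: every entry of $g$ is regular at $\lambda=\infty$ and $g(\infty)=I$. For $\alpha\neq\beta$ in $\mathbb C$ and a direct sum decomposition $\mathbb C^n=V\oplus W$ into complex subspaces (either of which may be $0$), let $$p_{\alpha,\beta,V,W}=\frac{\lambda-\alpha}{\lambda-\beta}\,\pi_V+\pi_W ,$$ where $\pi_V$ and $\pi_W$ are the projections of $\mathbb C^n$ onto $V$ and $W$ along the other subspace. **Theorem.** The group $\mathcal L^-\mathrm{GL}_n\mathbb C$ is generated by the projective loops $p_{\alpha,\beta,V,W}$; that is, the subgroup of $\mathrm{GL}_n(\mathbb C(\lambda))$ generated by all $p_{\alpha,\beta,V,W}$ is equal to $\mathcal L^-\mathrm{GL}_n\mathbb C$. -/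

import Mathlib

noncomputable section

namespace RationalLoop

/-- The valuation of `ℂ(λ)` at `λ = ∞`, sending a nonzero `p / q` to `exp (deg p - deg q)`. -/
def placeAtInfty : Valuation (RatFunc ℂ) (WithZero (Multiplicative ℤ)) :=
  letI : DecidableEq (RatFunc ℂ) := Classical.decEq _
  RatFunc.inftyValuation ℂ

/-- The rational function `f` is regular at `λ = ∞` with value `f(∞) = c`: the difference `f - c`
has negative degree or is zero, that is, it vanishes at infinity. -/
def HasValueAtInfty (f : RatFunc ℂ) (c : ℂ) : Prop :=
  placeAtInfty (f - RatFunc.C c) < 1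

/-- An `n × n` matrix of rational functions is normalized at infinity: it is regular there, with
value the identity matrix. -/
def IsNormalized {n : ℕ} (A : Matrix (Fin n) (Fin n) (RatFunc ℂ)) : Prop :=
  ∀ i j, HasValueAtInfty (A i j) ((1 : Matrix (Fin n) (Fin n) ℂ) i j)

theorem isNormalized_iff {n : ℕ} (A : Matrix (Fin n) (Fin n) (RatFunc ℂ)) :
    IsNormalized A ↔ ∀ i j, placeAtInfty ((A - 1) i j) < 1 := by
  refine forall_congr' fun i => forall_congr' fun j => ?_
  rw [HasValueAtInfty, Matrix.sub_apply, Matrix.one_apply, Matrix.one_apply]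
  split_ifs <;> simp

theorem isNormalized_one {n : ℕ} : IsNormalized (1 : Matrix (Fin n) (Fin n) (RatFunc ℂ)) := by
  rw [isNormalized_iff]
  intro i j
  simp

theorem IsNormalized.le_one {n : ℕ} {A : Matrix (Fin n) (Fin n) (RatFunc ℂ)}
    (hA : IsNormalized A) (i j : Fin n) : placeAtInfty (A i j) ≤ 1 := by
  rw [isNormalized_iff] at hA
  have h : A i j = (A - 1) i j + (1 : Matrix (Fin n) (Fin n) (RatFunc ℂ)) i j := by simp
  rw [h]
  refine Valuation.map_add_le _ (hA i j).le ?_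
  rw [Matrix.one_apply]
  split_ifs <;> simp

theorem IsNormalized.mul {n : ℕ} {A B : Matrix (Fin n) (Fin n) (RatFunc ℂ)}
    (hA : IsNormalized A) (hB : IsNormalized B) : IsNormalized (A * B) := by
  have hB1 := hB.le_one
  rw [isNormalized_iff] at hA hB ⊢
  intro i j
  have h : A * B - 1 = (A - 1) * B + (B - 1) := by noncomm_ring
  rw [h, Matrix.add_apply, Matrix.mul_apply]
  refine Valuation.map_add_lt _ (Valuation.map_sum_lt _ one_ne_zero fun k _ => ?_) (hB i j)
  rw [map_mul]
  exact mul_lt_one_of_lt_of_le (hA i k) (hB1 k j)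

theorem IsNormalized.inv {n : ℕ} {A B : Matrix (Fin n) (Fin n) (RatFunc ℂ)}
    (hA : IsNormalized A) (hAB : A * B = 1) : IsNormalized B := by
  rw [isNormalized_iff] at hA
  have h : B = 1 - (A - 1) * B := by rw [sub_mul, hAB]; noncomm_ring
  have key : ∀ i j, placeAtInfty (B i j) ≤ 1 := by
    intro i j
    have : Nonempty (Fin n) := ⟨i⟩
    obtain ⟨k, hk⟩ := Finite.exists_max fun k => placeAtInfty (B k j)
    refine (hk i).trans ?_
    by_contra! hlt
    have hpos : (0 : WithZero (Multiplicative ℤ)) < placeAtInfty (B k j) :=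
      lt_trans zero_lt_one hlt
    have : placeAtInfty (B k j) < placeAtInfty (B k j) := by
      conv_lhs => rw [h, Matrix.sub_apply, Matrix.mul_apply]
      refine Valuation.map_sub_lt _ ?_ (Valuation.map_sum_lt _ hpos.ne' fun l _ => ?_)
      · refine lt_of_le_of_lt ?_ hlt
        rw [Matrix.one_apply]
        split_ifs <;> simp
      · rw [map_mul]
        calc _ ≤ placeAtInfty ((A - 1) k l) * placeAtInfty (B k j) :=
              mul_le_mul_right (hk l) _
          _ < 1 * placeAtInfty (B k j) := by
              exact mul_lt_mul_of_pos_right (hA k l) hpos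
          _ = _ := one_mul _
    exact lt_irrefl _ this
  rw [isNormalized_iff]
  intro i j
  have h2 : B - 1 = -((A - 1) * B) := by rw [sub_mul, hAB]; noncomm_ring
  rw [h2, Matrix.neg_apply, Valuation.map_neg, Matrix.mul_apply]
  refine Valuation.map_sum_lt _ one_ne_zero fun k _ => ?_
  rw [map_mul]
  exact mul_lt_one_of_lt_of_le (hA i k) (key k j)

/-- The full rational loop group `ℒ⁻ GLₙ(ℂ)`: all nondegenerate `n × n` matrices `g` of rational
functions with `g(∞) = I`, as a subgroup of `GLₙ(ℂ(λ))`. -/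
def loopGroup (n : ℕ) : Subgroup (Matrix.GeneralLinearGroup (Fin n) (RatFunc ℂ)) where
  carrier := {g | IsNormalized (g : Matrix (Fin n) (Fin n) (RatFunc ℂ))}
  one_mem' := isNormalized_one
  mul_mem' ha hb := IsNormalized.mul ha hb
  inv_mem' {g} hg := IsNormalized.inv hg g.mul_inv

/-- The matrix, in the standard basis and with entries viewed as constant rational functions, of
the projection of `ℂⁿ` onto `V` along `W`. -/
def projMatrix {n : ℕ} (V W : Submodule ℂ (Fin n → ℂ)) (h : IsCompl V W) :
    Matrix (Fin n) (Fin n) (RatFunc ℂ) :=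
  (LinearMap.toMatrix' (V.projection W h)).map RatFunc.C

theorem projMatrix_add {n : ℕ} (V W : Submodule ℂ (Fin n → ℂ)) (h : IsCompl V W) :
    projMatrix V W h + projMatrix W V h.symm = 1 := by
  rw [projMatrix, projMatrix, ← Matrix.map_add _ (map_add _), ← map_add,
    Submodule.projection_add_projection_eq_id, LinearMap.toMatrix'_id]
  simp

theorem projMatrix_mul_self {n : ℕ} (V W : Submodule ℂ (Fin n → ℂ)) (h : IsCompl V W) :
    projMatrix V W h * projMatrix V W h = projMatrix V W h := by
  rw [projMatrix, ← Matrix.map_mul, ← LinearMap.toMatrix'_mul,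
    (Submodule.isIdempotentElem_projection h).eq]

/-- The matrix `((λ - α) / (λ - β)) π_V + π_W` over `ℂ(λ)`, where `ℂⁿ = V ⊕ W`. -/
def projLoopMatrix {n : ℕ} (α β : ℂ) (V W : Submodule ℂ (Fin n → ℂ)) (h : IsCompl V W) :
    Matrix (Fin n) (Fin n) (RatFunc ℂ) :=
  ((RatFunc.X - RatFunc.C α) / (RatFunc.X - RatFunc.C β)) • projMatrix V W h
    + projMatrix W V h.symm

theorem X_sub_C_ne_zero (α : ℂ) : (RatFunc.X - RatFunc.C α : RatFunc ℂ) ≠ 0 := by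
  rw [← RatFunc.algebraMap_X, ← RatFunc.algebraMap_C, ← map_sub]
  exact RatFunc.algebraMap_ne_zero (Polynomial.X_sub_C_ne_zero α)

theorem smul_add_compl_mul {K : Type*} [Field K] {n : ℕ} (r s : K) (hrs : r * s = 1)
    (P : Matrix (Fin n) (Fin n) K) (hP : P * P = P) :
    (r • P + (1 - P)) * (s • P + (1 - P)) = 1 := by
  have h0 : P * (1 - P) = 0 := by rw [mul_sub, mul_one, hP, sub_self]
  have h0' : (1 - P) * P = 0 := by rw [sub_mul, one_mul, hP, sub_self]
  have h1 : (1 - P) * (1 - P) = 1 - P := by rw [mul_sub, mul_one, h0', sub_zero]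
  rw [add_mul, mul_add, mul_add, smul_mul_smul_comm, hP, hrs, smul_mul_assoc, mul_smul_comm, h0,
    h0', h1]
  simp

theorem projLoopMatrix_mul {n : ℕ} (α β : ℂ) (V W : Submodule ℂ (Fin n → ℂ)) (h : IsCompl V W) :
    projLoopMatrix α β V W h * projLoopMatrix β α V W h = 1 := by
  have h1 := projMatrix_mul_self V W h
  have h2 : projMatrix W V h.symm = 1 - projMatrix V W h :=
    eq_sub_of_add_eq' (projMatrix_add V W h)
  have ha := X_sub_C_ne_zero α
  have hb := X_sub_C_ne_zero β
  have hc : ((RatFunc.X - RatFunc.C α : RatFunc ℂ) / (RatFunc.X - RatFunc.C β)) *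
      ((RatFunc.X - RatFunc.C β) / (RatFunc.X - RatFunc.C α)) = 1 := by
    field_simp
  rw [projLoopMatrix, projLoopMatrix, h2]
  exact smul_add_compl_mul _ _ hc _ h1

/-- The projective loop `p_{α,β,V,W} = ((λ - α) / (λ - β)) π_V + π_W`, as an invertible matrix;
its inverse is `p_{β,α,V,W}`. -/
def projLoop {n : ℕ} (α β : ℂ) (V W : Submodule ℂ (Fin n → ℂ)) (h : IsCompl V W) :
    Matrix.GeneralLinearGroup (Fin n) (RatFunc ℂ) where
  val := projLoopMatrix α β V W h
  inv := projLoopMatrix β α V W h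
  val_inv := projLoopMatrix_mul α β V W h
  inv_val := projLoopMatrix_mul β α V W h

/-- The set of all projective loops `p_{α,β,V,W}` with `α ≠ β` in `ℂ` and `ℂⁿ = V ⊕ W`. -/
def projLoops (n : ℕ) : Set (Matrix.GeneralLinearGroup (Fin n) (RatFunc ℂ)) :=
  {g | ∃ (α β : ℂ) (V W : Submodule ℂ (Fin n → ℂ)) (h : IsCompl V W),
    α ≠ β ∧ g = projLoop α β V W h}

end RationalLoop

end

noncomputable section

namespace RationalLoop

open Matrix

variable {n : ℕ}

/-! Projective loops are normalized because `(λ - α)/(λ - β)` is `1` at infinity. Conversely, a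
normalized matrix is the identity modulo the maximal ideal of the valuation ring at infinity, so
Gauss–Jordan elimination never meets a bad pivot, and it remains to generate the matrices used in
it. Diagonal ones (`one_add_single_self`): an entry with value `1` at infinity is a quotient of
monic polynomials of equal degree, which split over `ℂ` into linear factors. Elementary ones
(`one_add_single_of_ne`): these are commutators of a diagonal loop with a constant matrix, and
constant conjugation preserves the generated group (`conj_const`). -/

/-! ### Rational functions at infinity -/

theorem placeAtInfty_algebraMap {p : Polynomial ℂ} (hp : p ≠ 0) :
    placeAtInfty (algebraMap (Polynomial ℂ) (RatFunc ℂ) p) = WithZero.exp (p.natDegree : ℤ) := by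
  classical
  exact RatFunc.inftyValuation.polynomial ℂ hp

theorem placeAtInfty_div_lt_one {p q : Polynomial ℂ} (hq : q ≠ 0) :
    placeAtInfty (algebraMap _ (RatFunc ℂ) p / algebraMap _ (RatFunc ℂ) q) < 1 ↔
      p.degree < q.degree := by
  by_cases hp : p = 0
  · simp [hp, bot_lt_iff_ne_bot, hq]
  · rw [map_div₀, placeAtInfty_algebraMap hp, placeAtInfty_algebraMap hq,
      div_lt_one₀ (by simp), WithZero.exp_lt_exp, Polynomial.degree_eq_natDegree hp,
      Polynomial.degree_eq_natDegree hq]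
    norm_cast

theorem placeAtInfty_eq_one {u : RatFunc ℂ} (hu : placeAtInfty (u - 1) < 1) :
    placeAtInfty u = 1 := by
  have h := placeAtInfty.map_one_add_of_lt hu
  rwa [add_sub_cancel] at h

theorem placeAtInfty_X_sub_C_div (α β : ℂ) :
    placeAtInfty ((RatFunc.X - RatFunc.C α) / (RatFunc.X - RatFunc.C β) - 1) < 1 := by
  have hb := X_sub_C_ne_zero β
  have h : (RatFunc.X - RatFunc.C α) / (RatFunc.X - RatFunc.C β) - 1 =
      algebraMap _ (RatFunc ℂ) (Polynomial.C (β - α)) /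
        algebraMap _ (RatFunc ℂ) (Polynomial.X - Polynomial.C β) := by
    rw [map_sub (algebraMap (Polynomial ℂ) (RatFunc ℂ)), RatFunc.algebraMap_X,
      RatFunc.algebraMap_C, RatFunc.algebraMap_C, map_sub]
    field_simp
    ring
  rw [h, placeAtInfty_div_lt_one (Polynomial.X_sub_C_ne_zero β), Polynomial.degree_X_sub_C]
  exact lt_of_le_of_lt Polynomial.degree_C_le zero_lt_one

theorem placeAtInfty_C_le_one (c : ℂ) : placeAtInfty (RatFunc.C c) ≤ 1 := by
  classical
  by_cases hc : c = 0
  · simp [hc]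
  · exact (RatFunc.inftyValuation.C ℂ hc).le

/-- A rational function taking the value `1` at infinity is a quotient of monic polynomials of the
same degree. -/
theorem exists_monic_div_eq {u : RatFunc ℂ} (hu : placeAtInfty (u - 1) < 1) :
    ∃ p q : Polynomial ℂ, p.Monic ∧ q.Monic ∧ p.natDegree = q.natDegree ∧
      u = algebraMap _ (RatFunc ℂ) p / algebraMap _ (RatFunc ℂ) q := by
  have hq := RatFunc.monic_denom u
  have hq0 : algebraMap _ (RatFunc ℂ) u.denom ≠ 0 := RatFunc.algebraMap_ne_zero hq.ne_zero
  have h : u - 1 = algebraMap _ (RatFunc ℂ) (u.num - u.denom) /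
      algebraMap _ (RatFunc ℂ) u.denom := by
    rw [map_sub, sub_div, RatFunc.num_div_denom, div_self hq0]
  rw [h, placeAtInfty_div_lt_one hq.ne_zero] at hu
  have hs : u.denom + (u.num - u.denom) = u.num := add_sub_cancel _ _
  refine ⟨u.num, u.denom, ?_, hq, ?_, (RatFunc.num_div_denom u).symm⟩
  · rw [← hs]
    exact hq.add_of_left hu
  · rw [← hs]
    exact Polynomial.natDegree_eq_of_degree_eq (Polynomial.degree_add_eq_left_of_degree_lt hu)

/-! ### Projective loops are normalized -/

theorem projLoopMatrix_eq (α β : ℂ) (V W : Submodule ℂ (Fin n → ℂ)) (h : IsCompl V W) :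
    projLoopMatrix α β V W h =
      1 + ((RatFunc.X - RatFunc.C α) / (RatFunc.X - RatFunc.C β) - 1) • projMatrix V W h := by
  rw [projLoopMatrix, eq_sub_of_add_eq' (projMatrix_add V W h), sub_smul, one_smul]
  abel

theorem projLoop_mem_loopGroup (α β : ℂ) (V W : Submodule ℂ (Fin n → ℂ)) (h : IsCompl V W) :
    projLoop α β V W h ∈ loopGroup n := by
  change IsNormalized (projLoopMatrix α β V W h)
  rw [isNormalized_iff]
  intro i j
  rw [projLoopMatrix_eq, add_sub_cancel_left, Matrix.smul_apply, smul_eq_mul, map_mul]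
  exact mul_lt_one_of_lt_of_le (placeAtInfty_X_sub_C_div α β) (placeAtInfty_C_le_one _)

theorem closure_projLoops_le (n : ℕ) : Subgroup.closure (projLoops n) ≤ loopGroup n := by
  rw [Subgroup.closure_le]
  rintro _ ⟨α, β, V, W, h, -, rfl⟩
  exact projLoop_mem_loopGroup α β V W h

/-! ### Products of projective loops and constant conjugation -/

/-- The matrix `A` is a product of projective loops and their inverses. -/
def IsProjProduct (A : Matrix (Fin n) (Fin n) (RatFunc ℂ)) : Prop :=
  ∃ g ∈ Subgroup.closure (projLoops n), (g : Matrix (Fin n) (Fin n) (RatFunc ℂ)) = A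

namespace IsProjProduct

variable {A B : Matrix (Fin n) (Fin n) (RatFunc ℂ)}

theorem one : IsProjProduct (1 : Matrix (Fin n) (Fin n) (RatFunc ℂ)) :=
  ⟨1, one_mem _, rfl⟩

theorem mul (hA : IsProjProduct A) (hB : IsProjProduct B) : IsProjProduct (A * B) := by
  obtain ⟨g, hg, rfl⟩ := hA
  obtain ⟨k, hk, rfl⟩ := hB
  exact ⟨g * k, mul_mem hg hk, rfl⟩

theorem of_mul_eq_one (hA : IsProjProduct A) (hAB : A * B = 1) : IsProjProduct B := by
  obtain ⟨g, hg, rfl⟩ := hA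
  exact ⟨g⁻¹, inv_mem hg, Units.inv_eq_of_mul_eq_one_right hAB⟩

theorem isNormalized (hA : IsProjProduct A) : IsNormalized A := by
  obtain ⟨g, hg, rfl⟩ := hA
  exact closure_projLoops_le n hg

/-- Every constant idempotent matrix is the matrix of a projection. -/
theorem of_isIdempotentElem (α β : ℂ) {P : Matrix (Fin n) (Fin n) ℂ} (hP : IsIdempotentElem P) :
    IsProjProduct (1 + ((RatFunc.X - RatFunc.C α) / (RatFunc.X - RatFunc.C β) - 1) •
      P.map (RatFunc.C : ℂ → RatFunc ℂ)) := by
  -- Not a projective loop, but the identity; this case occurs later, when `0` is a root of the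
  -- polynomial being factored.
  by_cases hαβ : α = β
  · rw [hαβ, div_self (X_sub_C_ne_zero β), sub_self, zero_smul, add_zero]
    exact one
  have hP' : IsIdempotentElem (Matrix.toLin' P) := by
    rw [IsIdempotentElem, Module.End.mul_eq_comp, ← Matrix.toLin'_mul, hP.eq]
  refine ⟨projLoop α β _ _ (LinearMap.IsIdempotentElem.isCompl hP'),
    Subgroup.subset_closure ⟨α, β, _, _, _, hαβ, rfl⟩, ?_⟩
  change projLoopMatrix _ _ _ _ _ = _
  rw [projLoopMatrix_eq, projMatrix, ← LinearMap.IsIdempotentElem.eq_projection hP',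
    LinearMap.toMatrix'_toLin']

/-- Conjugation by a constant matrix only replaces the idempotent `P` of a projective loop by the
constant idempotent `T P T⁻¹`, so it maps generators to generators. -/
theorem conj_const (hA : IsProjProduct A) {T S : Matrix (Fin n) (Fin n) ℂ} (hTS : T * S = 1) :
    IsProjProduct (T.map (RatFunc.C : ℂ → RatFunc ℂ) * A * S.map (RatFunc.C : ℂ → RatFunc ℂ)) := by
  have hST : S * T = 1 := mul_eq_one_comm.mp hTS
  have hTS' : T.map (RatFunc.C : ℂ → RatFunc ℂ) * S.map (RatFunc.C : ℂ → RatFunc ℂ) = 1 := by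
    rw [← Matrix.map_mul, hTS]; simp
  have hST' : S.map (RatFunc.C : ℂ → RatFunc ℂ) * T.map (RatFunc.C : ℂ → RatFunc ℂ) = 1 := by
    rw [← Matrix.map_mul, hST]; simp
  let t : Matrix.GeneralLinearGroup (Fin n) (RatFunc ℂ) := ⟨_, _, hTS', hST'⟩
  obtain ⟨g, hg, rfl⟩ := hA
  refine ⟨MulAut.conj t g, ?_, rfl⟩
  suffices h : Subgroup.closure (projLoops n) ≤
      (Subgroup.closure (projLoops n)).comap (MulAut.conj t).toMonoidHom from h hg
  rw [Subgroup.closure_le]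
  rintro _ ⟨α, β, V, W, h, -, rfl⟩
  have hQ : IsIdempotentElem (LinearMap.toMatrix' (V.projection W h)) := by
    rw [IsIdempotentElem, ← LinearMap.toMatrix'_mul,
      (Submodule.isIdempotentElem_projection h).eq]
  have hP : IsIdempotentElem (T * LinearMap.toMatrix' (V.projection W h) * S) := by
    rw [IsIdempotentElem]
    calc _ = T * LinearMap.toMatrix' (V.projection W h) * (S * T) *
          LinearMap.toMatrix' (V.projection W h) * S := by noncomm_ring
      _ = _ := by rw [hST, mul_one, mul_assoc T, hQ.eq]
  obtain ⟨g, hg, hgP⟩ := of_isIdempotentElem α β hP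
  suffices MulAut.conj t (projLoop α β V W h) = g by
    change MulAut.conj t (projLoop α β V W h) ∈ Subgroup.closure (projLoops n)
    rwa [this]
  refine Units.ext ?_
  rw [hgP]
  change T.map (RatFunc.C : ℂ → RatFunc ℂ) * projLoopMatrix α β V W h *
    S.map (RatFunc.C : ℂ → RatFunc ℂ) = _
  rw [projLoopMatrix_eq, projMatrix, Matrix.map_mul, Matrix.map_mul, mul_add, add_mul, mul_one,
    hTS', mul_smul_comm, smul_mul_assoc]

/-! ### Diagonal, elementary and single-column loops -/

theorem one_add_single_mul {k : Fin n} {u w : RatFunc ℂ}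
    (hu : IsProjProduct (1 + single k k (u - 1))) (hw : IsProjProduct (1 + single k k (w - 1))) :
    IsProjProduct (1 + single k k (u * w - 1)) := by
  convert hu.mul hw using 1
  rw [add_mul, one_mul, mul_add, mul_one, single_mul_single_same, add_assoc, ← single_add,
    ← single_add]
  congr 2
  ring

theorem one_add_single_inv {k : Fin n} {u : RatFunc ℂ} (hu0 : u ≠ 0)
    (hu : IsProjProduct (1 + single k k (u - 1))) :
    IsProjProduct (1 + single k k (u⁻¹ - 1)) := by
  refine hu.of_mul_eq_one ?_
  rw [add_mul, one_mul, mul_add, mul_one, single_mul_single_same, add_assoc, ← single_add,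
    ← single_add]
  convert add_zero _
  convert single_zero k k
  field_simp
  ring

/-- Each root `a` of `p` contributes one factor `(λ - a)/λ`; dividing by the power of `λ` makes the
value at infinity `1`. -/
theorem one_add_single_monic_div_X_pow (k : Fin n) {p : Polynomial ℂ} (hp : p.Monic) :
    IsProjProduct (1 + single k k
      (algebraMap _ (RatFunc ℂ) p / RatFunc.X ^ p.natDegree - 1)) := by
  have key : ∀ s : Multiset ℂ, IsProjProduct (1 + single k k
      (algebraMap _ (RatFunc ℂ) (s.map fun a => Polynomial.X - Polynomial.C a).prod /
        RatFunc.X ^ s.card - 1)) := by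
    intro s
    induction s using Multiset.induction with
    | empty => simpa using one
    | cons a s ih =>
      have ha : IsProjProduct (1 + single k k
          ((RatFunc.X - RatFunc.C a) / (RatFunc.X - RatFunc.C 0) - 1)) := by
        convert of_isIdempotentElem a 0 (P := single k k (1 : ℂ))
          (by rw [IsIdempotentElem, single_mul_single_same, one_mul]) using 2
        rw [Matrix.map_single, smul_single, map_one, smul_eq_mul, mul_one]
      convert ha.one_add_single_mul ih using 4
      rw [Multiset.map_cons, Multiset.prod_cons, Multiset.card_cons, map_mul, map_sub,
        RatFunc.algebraMap_X, RatFunc.algebraMap_C, map_zero, sub_zero, pow_succ',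
        mul_div_mul_comm]
  have hs := IsAlgClosed.splits p
  have h := key p.roots
  rwa [← hs.natDegree_eq_card_roots, ← hs.eq_prod_roots_of_monic hp] at h

theorem one_add_single_self (k : Fin n) {u : RatFunc ℂ} (hu : placeAtInfty (u - 1) < 1) :
    IsProjProduct (1 + single k k (u - 1)) := by
  obtain ⟨p, q, hp, hq, hpq, rfl⟩ := exists_monic_div_eq hu
  have hX : (RatFunc.X : RatFunc ℂ) ^ q.natDegree ≠ 0 := pow_ne_zero _ RatFunc.X_ne_zero
  have hq0 : algebraMap _ (RatFunc ℂ) q ≠ 0 := RatFunc.algebraMap_ne_zero hq.ne_zero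
  -- Equal degrees let the powers of `λ` cancel: `p/q = (p/λ^d) (q/λ^d)⁻¹`.
  convert (one_add_single_monic_div_X_pow k hp).one_add_single_mul
    (one_add_single_inv (div_ne_zero hq0 hX) (one_add_single_monic_div_X_pow k hq)) using 4
  rw [hpq]
  field_simp

/-- An elementary matrix is the commutator of a diagonal loop and a constant elementary matrix. -/
theorem one_add_single_of_ne {i k : Fin n} (hik : i ≠ k) {f : RatFunc ℂ}
    (hf : placeAtInfty f < 1) : IsProjProduct (1 + single i k f) := by
  have hu : placeAtInfty ((1 + f) - 1) < 1 := by rwa [add_sub_cancel_left]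
  have hu0 : 1 + f ≠ 0 := by
    intro h
    have := placeAtInfty_eq_one hu
    rw [h, map_zero] at this
    exact zero_ne_one this
  have hD := one_add_single_self i hu
  have hT : (1 + single i k (1 : ℂ)) * (1 + single i k (-1 : ℂ)) = 1 := by
    rw [add_mul, one_mul, mul_add, mul_one, single_mul_single_of_ne _ _ _ _ hik.symm, add_zero,
      add_assoc, ← single_add]
    simp
  have hmap : ∀ c : ℂ, (1 + single i k c).map (RatFunc.C : ℂ → RatFunc ℂ) =
      1 + single i k (RatFunc.C c) := by
    intro c
    rw [Matrix.map_add _ (map_add _), Matrix.map_single, Matrix.map_one _ (map_zero _) (map_one _)]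
  -- With `D = 1 + f E_ii` and `T = 1 + E_ik`, the product `D (T D⁻¹ T⁻¹)` equals `(1 + (1 + f)
  -- E_ik)(1 - E_ik) = 1 + f E_ik`.
  convert hD.mul ((one_add_single_inv hu0 hD).conj_const hT) using 1
  rw [hmap, hmap]
  simp only [mul_add, add_mul, mul_one, one_mul, single_mul_single_same,
    single_mul_single_of_ne _ _ _ _ hik.symm, add_zero, map_one, map_neg]
  ext a b
  simp only [Matrix.add_apply, Matrix.single_apply]
  split_ifs <;> field_simp <;> ring

/-- A normalized matrix which differs from the identity in a single column. -/
theorem of_col (k : Fin n) (a : Fin n → RatFunc ℂ) (ha : ∀ i, placeAtInfty (a i) < 1) :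
    IsProjProduct (1 + ∑ i, single i k (a i)) := by
  -- Right multiplication by `1 + a_i E_ik` with `i ≠ k` just adds the entry `a_i`, since every
  -- `E_jk E_ik` vanishes.
  have key : ∀ t : Finset (Fin n), k ∉ t →
      IsProjProduct (1 + single k k (a k) + ∑ i ∈ t, single i k (a i)) := by
    intro t
    induction t using Finset.induction with
    | empty =>
      intro _
      have := one_add_single_self k (u := 1 + a k) (by rw [add_sub_cancel_left]; exact ha k)
      rw [add_sub_cancel_left] at this
      simpa using this
    | insert i t hi ih =>
      intro hk
      rw [Finset.mem_insert, not_or] at hk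
      have h0 : (∑ j ∈ t, single j k (a j)) * single i k (a i) = 0 := by
        rw [Finset.sum_mul]
        exact Finset.sum_eq_zero fun j _ => single_mul_single_of_ne _ _ _ _ hk.1 _
      convert (ih hk.2).mul (one_add_single_of_ne (Ne.symm hk.1) (ha i)) using 1
      rw [Finset.sum_insert hi, mul_add, mul_one, add_mul, add_mul, one_mul,
        single_mul_single_of_ne _ _ _ _ hk.1, h0]
      abel
  have h := key (Finset.univ.erase k) (Finset.notMem_erase k _)
  rwa [add_assoc, Finset.add_sum_erase _ (fun i => single i k (a i)) (Finset.mem_univ k)] at h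

theorem col_apply (k : Fin n) (a : Fin n → RatFunc ℂ) (i j : Fin n) :
    (1 + ∑ i, single i k (a i)) i j =
      (1 : Matrix (Fin n) (Fin n) (RatFunc ℂ)) i j + if j = k then a i else 0 := by
  rw [Matrix.add_apply, Matrix.sum_apply]
  simp [Matrix.single_apply, ite_and, eq_comm]

end IsProjProduct

/-! ### Gauss–Jordan elimination -/

/-- Gauss–Jordan elimination: the columns outside `t` are already those of the identity. -/
theorem IsNormalized.isProjProduct_of_col_eq (t : Finset (Fin n)) :
    ∀ A : Matrix (Fin n) (Fin n) (RatFunc ℂ), IsNormalized A →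
      (∀ j ∉ t, ∀ i, A i j = (1 : Matrix (Fin n) (Fin n) (RatFunc ℂ)) i j) →
      IsProjProduct A := by
  induction t using Finset.induction with
  | empty =>
    intro A _ h
    have : A = 1 := by ext i j; exact h j (Finset.notMem_empty j) i
    rw [this]
    exact .one
  | insert k t hk ih =>
    intro A hA h
    have hM := IsProjProduct.of_col k (fun i => (A - 1) i k)
      fun i => (isNormalized_iff A).mp hA i k
    set M : Matrix (Fin n) (Fin n) (RatFunc ℂ) := 1 + ∑ i, single i k ((A - 1) i k) with hMdef
    have hMcol : ∀ j ∉ t, ∀ i, A i j = M i j := by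
      intro j hj i
      rw [hMdef, IsProjProduct.col_apply]
      split_ifs with hjk
      · rw [hjk, Matrix.sub_apply, add_sub_cancel]
      · rw [add_zero]
        exact h j (by simp [hjk, hj]) i
    obtain ⟨g, hg, hgM⟩ := hM
    have hN : IsProjProduct (↑g⁻¹ : Matrix (Fin n) (Fin n) (RatFunc ℂ)) := ⟨g⁻¹, inv_mem hg, rfl⟩
    have hNM : (↑g⁻¹ : Matrix (Fin n) (Fin n) (RatFunc ℂ)) * M = 1 := by
      rw [← hgM]; exact g.inv_mul
    have hMN : M * (↑g⁻¹ : Matrix (Fin n) (Fin n) (RatFunc ℂ)) = 1 := by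
      rw [← hgM]; exact g.mul_inv
    -- `M` is the identity with column `k` taken from `A`, so it agrees with `A` in all columns
    -- outside `t`, and `M⁻¹ A` has identity columns there.
    have hNA := ih ((↑g⁻¹ : Matrix (Fin n) (Fin n) (RatFunc ℂ)) * A) (hN.isNormalized.mul hA) <| by
      intro j hj i
      rw [← hNM, Matrix.mul_apply, Matrix.mul_apply]
      exact Finset.sum_congr rfl fun l _ => by rw [hMcol j hj l]
    have := IsProjProduct.mul ⟨g, hg, hgM⟩ hNA
    rwa [← mul_assoc, hMN, one_mul] at this

end RationalLoop

end

theorem mainTheorem2 (n : ℕ) :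
    Subgroup.closure (RationalLoop.projLoops n) = RationalLoop.loopGroup n := by
  refine le_antisymm (RationalLoop.closure_projLoops_le n) fun g hg => ?_
  obtain ⟨k, hk, hkg⟩ := RationalLoop.IsNormalized.isProjProduct_of_col_eq Finset.univ _ hg
    fun j hj => absurd (Finset.mem_univ j) hj
  rwa [← Units.ext hkg]
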